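/- Let $(Z_n)_{n\ge 0}$ be the Lagonacci sequence, defined by $Z_0=1$, $Z_1=2$, $Z_2=3$ and $Z_{n+1}=Z_{n-1}+Z_{n-2}$ for $n\ge 2$. For an integer $m\ge 0$, the greedy decomposition of $m$ is obtained by repeatedly choosing the largest index $j$ such that $Z_j$ is at most the current remainder (initially $m$) and subtracting $Z_j$, until the remainder is $0$; let $k(m)$ be the number of summands so obtained (so $k(0)=0$). For $N\ge 0$ let $K_N=k(m)$, where $m$ is chosen uniformly at random from the integers in $[0,Z_N)$. Let $$\lambda=\left(\frac{9-\sqrt{69}}{18}\right)^{1/3}+\left(\frac{9+\sqrt{69}}{18}\right)^{1/3}$$ (the plastic ratio, i.e. the real root of $x^3-x-1$), and put $$C_1=\frac{\lambda-1}{5\lambda-4},\qquad C_2=\frac{\lambda(\lambda-1)}{(5\lambda-4)^3}.$$ Then $|C_1-0.123769|<10^{-6}$ and $|C_2-0.023820|<10^{-6}$, and as $N\to\infty$ $$\mathbb{E}[K_N]=C_1N+O(1),\qquad \mathrm{Var}(K_N)=C_2N+O(1).$$ Furthermore, the normalized random variables $$X_N=\frac{K_N-\mathbb{E}[K_N]}{\sqrt{\mathrm{Var}(K_N)}}$$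 converge in distribution to the standard normal distribution $\mathcal{N}(0,1)$. -/

import Mathlib

open MeasureTheory ProbabilityTheory Filter Asymptotics

/-- The Lagonacci sequence: `Z 0 = 1`, `Z 1 = 2`, `Z 2 = 3` and
`Z (n + 1) = Z (n - 1) + Z (n - 2)` for `n ≥ 2`. -/
def lagonacci : ℕ → ℕ
  | 0 => 1
  | 1 => 2
  | 2 => 3
  | n + 3 => lagonacci (n + 1) + lagonacci n

theorem lagonacci_pos : ∀ n, 0 < lagonacci n
  | 0 => by simp [lagonacci]
  | 1 => by simp [lagonacci]
  | 2 => by simp [lagonacci]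
  | n + 3 => by
    have := lagonacci_pos n
    simp only [lagonacci]
    omega

theorem le_lagonacci : ∀ n, n ≤ lagonacci n
  | 0 => by simp [lagonacci]
  | 1 => by simp [lagonacci]
  | 2 => by simp [lagonacci]
  | 3 => by simp [lagonacci]
  | 4 => by simp [lagonacci]
  | n + 5 => by
    have h1 := le_lagonacci (n + 3)
    have h2 := le_lagonacci (n + 2)
    have h : lagonacci (n + 5) = lagonacci (n + 3) + lagonacci (n + 2) := by
      simp only [lagonacci]
    omega

/-- The greedy choice for `m ≥ 1`: the largest index `j` with `Z j ≤ m`. -/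
def greedyIndex (m : ℕ) : ℕ := Nat.findGreatest (fun j => lagonacci j ≤ m) m

theorem isGreatest_greedyIndex {m : ℕ} (hm : 0 < m) :
    IsGreatest {j | lagonacci j ≤ m} (greedyIndex m) := by
  refine ⟨?_, fun j hj => ?_⟩
  · exact Nat.findGreatest_spec (P := fun j => lagonacci j ≤ m) (Nat.zero_le m)
      (by simp only [lagonacci]; omega)
  · exact Nat.le_findGreatest ((le_lagonacci j).trans hj) hj

/-- The list of indices `[j₁, j₂, …, j_k]` produced by the greedy algorithm on `m`: choose the
largest `j` with `Z j ≤ m`, subtract `Z j`, and iterate until the remainder is zero. -/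
def greedyDecomposition (m : ℕ) : List ℕ :=
  if h : m = 0 then []
  else greedyIndex m :: greedyDecomposition (m - lagonacci (greedyIndex m))
termination_by m
decreasing_by
  have := lagonacci_pos (greedyIndex m)
  omega

/-- The greedy decomposition of `m` is a decomposition of `m`. -/
theorem sum_greedyDecomposition (m : ℕ) :
    ((greedyDecomposition m).map lagonacci).sum = m := by
  induction m using Nat.strong_induction_on with
  | _ m ih =>
    rw [greedyDecomposition]
    split_ifs with h
    · simp [h]
    · have h1 := lagonacci_pos (greedyIndex m)
      have h2 : lagonacci (greedyIndex m) ≤ m := (isGreatest_greedyIndex (by omega)).1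
      rw [List.map_cons, List.sum_cons, ih _ (by omega)]
      omega

/-- `k(m)`, the number of summands in the greedy decomposition of `m`. -/
def greedyCount (m : ℕ) : ℕ := (greedyDecomposition m).length

/-- The law of an integer `m` chosen uniformly from `[0, Z_N)`. -/
noncomputable def uniformBelow (N : ℕ) : Measure ℕ := uniformOn (Set.Iio (lagonacci N))

instance instIsProbabilityMeasureUniformBelow (N : ℕ) :
    IsProbabilityMeasure (uniformBelow N) :=
  isProbabilityMeasure_uniformOn (Set.finite_Iio _) ⟨0, lagonacci_pos N⟩

/-- The random variable `K_N = k(m)`, for `m` distributed according to `uniformBelow N`. -/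
def summandCount (m : ℕ) : ℝ := (greedyCount m : ℝ)

/-- The mean of `K_N`. -/
noncomputable def meanK (N : ℕ) : ℝ := ∫ m, summandCount m ∂(uniformBelow N)

/-- The variance of `K_N`. -/
noncomputable def varK (N : ℕ) : ℝ := variance summandCount (uniformBelow N)

/-- The plastic ratio, the real root of `x ^ 3 - x - 1`. -/
noncomputable def plasticRatio : ℝ :=
  ((9 - √69) / 18) ^ ((1 : ℝ) / 3) + ((9 + √69) / 18) ^ ((1 : ℝ) / 3)

/-- The constant `C₁` of the mean. -/
noncomputable def meanConst : ℝ := (plasticRatio - 1) / (5 * plasticRatio - 4)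

/-- The constant `C₂` of the variance. -/
noncomputable def varConst : ℝ :=
  plasticRatio * (plasticRatio - 1) / (5 * plasticRatio - 4) ^ 3

/-! The gap between Z_{n+4} and Z_{n+5} is exactly Z_n, so [0, Z_{n+5}) splits into [0, Z_{n+4}) and
a translate of [0, Z_n) on which greedy uses one extra summand (`countSum_add_five`). Hence F_n(t) =
∑ t^{k(m)}, summed over m < Z_n, satisfies F_{n+5} = F_{n+4} + t F_n, with characteristic equation
x^5 = x^4 + t. At t = 1 the dominant root is λ, since x^5 - x^4 - 1 = (x^3 - x - 1)(x^2 - x + 1).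

Dividing by the n-th power of the root gives x(n+5) = p x(n+4) + q x(n) + f(n) with p + q = 1. Near
t = 1 one has |q| < 1/4, so successive differences contract (`norm_succ_sub_le_of_recurrence`); the
other roots are never located. Applied to moments centred at C₁n, this bounds the first moment, and
the second after removal of C₂n; the mean and variance estimates follow.

For the limit law, the root is used as the parameter: x = λe^z, t = x^5 - x^4. The scaled F_n
converges to a nonzero limit along any z_n → 0 (`exists_tendsto_scaledGenFun`). Solving t = e^w
gives z = C₁w + C₂w²/2 + o(w²) (`exists_rootWeight_eq_exp`). With w = is/√Var, the characteristic
function tends to exp(-s²/2), and Lévy's continuity theorem concludes. -/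

open scoped Topology

/-! ### The greedy algorithm and the five-term recurrence. -/

theorem lagonacci_add_five : ∀ n, lagonacci (n + 5) = lagonacci (n + 4) + lagonacci n
  | 0 => by simp [lagonacci]
  | 1 => by simp [lagonacci]
  | 2 => by simp [lagonacci]
  | n + 3 => by
    have h1 := lagonacci_add_five (n + 1)
    have h2 := lagonacci_add_five n
    have a : ∀ k, lagonacci (k + 3) = lagonacci (k + 1) + lagonacci k := fun k => by
      simp only [lagonacci]
    have := a (n + 5)
    have := a (n + 4)
    have := a n
    simp only [add_assoc, Nat.reduceAdd] at *
    omega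

theorem lagonacci_mono : Monotone lagonacci := by
  refine monotone_nat_of_le_succ fun n => ?_
  match n with
  | 0 => simp [lagonacci]
  | 1 => simp [lagonacci]
  | 2 => simp [lagonacci]
  | 3 => simp [lagonacci]
  | n + 4 => rw [lagonacci_add_five]; omega

theorem greedyIndex_eq {m j : ℕ} (h₁ : lagonacci j ≤ m) (h₂ : m < lagonacci (j + 1)) :
    greedyIndex m = j := by
  have hg := isGreatest_greedyIndex ((lagonacci_pos j).trans_le h₁)
  refine le_antisymm ?_ (hg.2 h₁)
  by_contra! h
  exact absurd (hg.1 : lagonacci _ ≤ m) (not_le.2 (h₂.trans_le (lagonacci_mono h)))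

/-- The number lies in [Z_{n+4}, Z_{n+5}), so greedy removes Z_{n+4} first and is left with m. -/
theorem greedyCount_lagonacci_add {n m : ℕ} (h : m < lagonacci n) :
    greedyCount (lagonacci (n + 4) + m) = greedyCount m + 1 := by
  have hi : greedyIndex (lagonacci (n + 4) + m) = n + 4 :=
    greedyIndex_eq (by omega) (by rw [lagonacci_add_five]; omega)
  have hp := lagonacci_pos (n + 4)
  rw [greedyCount, greedyDecomposition, dif_neg (by omega), List.length_cons, hi,
    Nat.add_sub_cancel_left, greedyCount]

/-- The sum of `g (k m)` over all `m` in `[0, Z_n)`. -/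
def countSum {E : Type*} [AddCommMonoid E] (g : ℕ → E) (n : ℕ) : E :=
  ∑ m ∈ Finset.range (lagonacci n), g (greedyCount m)

/-- Leaving `g` arbitrary lets one recurrence serve both the real moments and the complex generating
function. -/
theorem countSum_add_five {E : Type*} [AddCommMonoid E] (g : ℕ → E) (n : ℕ) :
    countSum g (n + 5) = countSum g (n + 4) + countSum (fun k => g (k + 1)) n := by
  unfold countSum
  rw [lagonacci_add_five, Finset.sum_range_add]
  congr 1
  refine Finset.sum_congr rfl fun m hm => ?_
  rw [greedyCount_lagonacci_add (Finset.mem_range.1 hm)]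

/-! ### Expectations under the uniform law as finite sums. -/

theorem integrableOn_count_finset {E : Type*} [NormedAddCommGroup E] (f : ℕ → E)
    (s : Finset ℕ) : IntegrableOn f s Measure.count := by
  rw [← (s : Set ℕ).biUnion_of_singleton]
  simp [integrableOn_finset_iUnion]

theorem integrable_uniformBelow {E : Type*} [NormedAddCommGroup E] (f : ℕ → E) (N : ℕ) :
    Integrable f (uniformBelow N) := by
  rw [uniformBelow, uniformOn, ProbabilityTheory.cond]
  refine Integrable.smul_measure ?_ ?_
  · rw [← Finset.coe_Iio]
    exact integrableOn_count_finset f _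
  · simp [Set.Iio_eq_empty_iff, (lagonacci_pos N).ne']

theorem integral_uniformBelow {E : Type*} [NormedAddCommGroup E] [NormedSpace ℝ E]
    [CompleteSpace E] (g : ℕ → E) (N : ℕ) :
    ∫ m, g (greedyCount m) ∂(uniformBelow N) = (lagonacci N : ℝ)⁻¹ • countSum g N := by
  rw [uniformBelow, uniformOn, ProbabilityTheory.cond, integral_smul_measure, ← Finset.coe_Iio,
    setIntegral_finset _ (integrableOn_count_finset _ _), countSum, Measure.count_apply_finset,
    Nat.Iio_eq_range]
  simp

/-! ### The plastic ratio and the constants C₁, C₂. -/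

theorem plasticRatio_cube : plasticRatio ^ 3 = plasticRatio + 1 := by
  have h69 : √69 ^ 2 = 69 := Real.sq_sqrt (by norm_num)
  have hs : √69 < 9 := by
    rw [Real.sqrt_lt' (by norm_num)]; norm_num
  have hs0 : 0 ≤ √69 := Real.sqrt_nonneg _
  have ha : 0 ≤ (9 - √69) / 18 := by linarith
  have hb : 0 ≤ (9 + √69) / 18 := by linarith
  have hcube : ∀ x : ℝ, 0 ≤ x → (x ^ ((1 : ℝ) / 3)) ^ 3 = x := fun x hx => by
    rw [← Real.rpow_natCast, ← Real.rpow_mul hx]; norm_num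
  -- Cardano's relation uv = 1/3: the radicands multiply to (81 - 69)/324 = 1/27.
  have hprod : ((9 - √69) / 18) ^ ((1 : ℝ) / 3) * ((9 + √69) / 18) ^ ((1 : ℝ) / 3) = 1 / 3 := by
    rw [← Real.mul_rpow ha hb,
      show (9 - √69) / 18 * ((9 + √69) / 18) = (1 / 3) ^ (3 : ℝ) by
        norm_num; linear_combination -h69 / 324,
      ← Real.rpow_mul (by norm_num)]
    norm_num
  have h1 := hcube _ ha
  have h2 := hcube _ hb
  unfold plasticRatio
  set u := ((9 - √69) / 18) ^ ((1 : ℝ) / 3)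
  set v := ((9 + √69) / 18) ^ ((1 : ℝ) / 3)
  linear_combination h1 + h2 + 3 * (u + v) * hprod

theorem plasticRatio_pos : 0 < plasticRatio := by
  have hs : √69 < 9 := by
    rw [Real.sqrt_lt' (by norm_num)]; norm_num
  have hs0 : 0 ≤ √69 := Real.sqrt_nonneg _
  unfold plasticRatio
  have ha : 0 < (9 - √69) / 18 := by linarith
  have hb : 0 < (9 + √69) / 18 := by linarith
  positivity

theorem plasticRatio_gt : 1.3247179 < plasticRatio := by
  by_contra! h
  have h0 := plasticRatio_pos
  have h3 := plasticRatio_cube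
  have h1 : 1 < plasticRatio := by
    by_contra! h'
    nlinarith [mul_le_one₀ h' h0.le h', pow_le_one₀ (n := 3) h0.le h']
  nlinarith [mul_nonneg (sub_nonneg.2 h) (sub_nonneg.2 h1.le),
    mul_nonneg (mul_nonneg (sub_nonneg.2 h) (sub_nonneg.2 h1.le)) h0.le]

theorem plasticRatio_lt : plasticRatio < 1.324718 := by
  by_contra! h
  have h3 := plasticRatio_cube
  nlinarith [mul_nonneg (sub_nonneg.2 h) (sub_nonneg.2 h),
    mul_nonneg (mul_nonneg (sub_nonneg.2 h) (sub_nonneg.2 h)) plasticRatio_pos.le]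

theorem plasticRatio_pow_five : plasticRatio ^ 5 = plasticRatio ^ 4 + 1 := by
  linear_combination (plasticRatio ^ 2 - plasticRatio + 1) * plasticRatio_cube

/-- Both constants are rewritten through λ^4(λ - 1) = 1; the new denominator λ^4 + 5 is the
derivative of the weight t at z = 0. -/
theorem meanConst_eq : meanConst = 1 / (plasticRatio ^ 4 + 5) := by
  have h := plasticRatio_gt
  rw [meanConst, div_eq_div_iff (by linarith) (by positivity)]
  linear_combination plasticRatio_pow_five

theorem varConst_eq : varConst = plasticRatio ^ 9 / (plasticRatio ^ 4 + 5) ^ 3 := by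
  have h := plasticRatio_gt
  have h5 := plasticRatio_pow_five
  have h1 : plasticRatio ^ 4 + 5 = (5 * plasticRatio - 4) / (plasticRatio - 1) := by
    rw [eq_div_iff (by linarith)]
    linear_combination h5
  have h2 : (5 * plasticRatio - 4) ≠ 0 := by linarith
  have h3 : (plasticRatio - 1) ≠ 0 := by linarith
  have h4 : plasticRatio ^ 4 * (plasticRatio - 1) = 1 := by linear_combination h5
  rw [varConst, h1, div_pow, div_div_eq_mul_div]
  congr 1
  linear_combination (-plasticRatio * (plasticRatio - 1) *
    (plasticRatio ^ 4 * (plasticRatio - 1) + 1)) * h4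

theorem varConst_pos : 0 < varConst := by
  have := plasticRatio_pos
  rw [varConst_eq]; positivity

theorem abs_meanConst_sub_lt : |meanConst - 0.123769| < 0.000001 := by
  have h1 := plasticRatio_gt
  have h2 := plasticRatio_lt
  have h3 : 0 < 5 * plasticRatio - 4 := by linarith
  rw [meanConst, abs_sub_lt_iff, sub_lt_iff_lt_add, sub_lt_comm, div_lt_iff₀ h3, lt_div_iff₀ h3]
  constructor <;> linarith

theorem abs_varConst_sub_lt : |varConst - 0.023820| < 0.000001 := by
  have h1 := plasticRatio_gt
  have h2 := plasticRatio_lt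
  have h3 : 0 < 5 * plasticRatio - 4 := by linarith
  have h4 : 0 < (5 * plasticRatio - 4) ^ 3 := by positivity
  have hc : (5 * plasticRatio - 4) ^ 3 =
      125 * (plasticRatio + 1) - 300 * plasticRatio ^ 2 + 240 * plasticRatio - 64 := by
    linear_combination 125 * plasticRatio_cube
  rw [varConst, abs_sub_lt_iff, sub_lt_iff_lt_add, sub_lt_comm, div_lt_iff₀ h4, lt_div_iff₀ h4, hc]
  constructor <;> nlinarith [mul_pos (sub_pos.2 h1) (sub_pos.2 h2)]

/-! ### Recurrences with p + q = 1 and small q. -/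

/-- A sequence that decays at least geometrically with ratio `0.999`. -/
def GeomDecay {E : Type*} [Norm E] (f : ℕ → E) : Prop :=
  ∃ C : ℝ, ∀ n, ‖f n‖ ≤ C * 0.999 ^ n

section GeomDecay

variable {E : Type*} [NormedRing E] {f g : ℕ → E}

theorem GeomDecay.add (hf : GeomDecay f) (hg : GeomDecay g) :
    GeomDecay fun n => f n + g n := by
  obtain ⟨C, hC⟩ := hf
  obtain ⟨D, hD⟩ := hg
  refine ⟨C + D, fun n => (norm_add_le _ _).trans ?_⟩
  linarith [hC n, hD n]

theorem GeomDecay.const_mul (c : E) (hf : GeomDecay f) : GeomDecay fun n => c * f n := by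
  obtain ⟨C, hC⟩ := hf
  refine ⟨‖c‖ * C, fun n => (norm_mul_le _ _).trans ?_⟩
  rw [mul_assoc]
  exact mul_le_mul_of_nonneg_left (hC n) (norm_nonneg c)

theorem GeomDecay.shift (hf : GeomDecay f) (k : ℕ) : GeomDecay fun n => f (n + k) := by
  obtain ⟨C, hC⟩ := hf
  refine ⟨C * 0.999 ^ k, fun n => (hC _).trans_eq ?_⟩
  ring

theorem GeomDecay.sub_add_four (hf : GeomDecay fun n => f (n + 1) - f n) :
    GeomDecay fun n => f (n + 4) - f n := by
  have h := (((hf.shift 3).add (hf.shift 2)).add (hf.shift 1)).add hf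
  simpa [add_assoc] using h

end GeomDecay

section Recurrence

variable {𝕜 : Type*} [NormedField 𝕜] {p q : 𝕜} {x f : ℕ → 𝕜} {D : ℝ}

/-- Since `4 ‖q‖ < 1`, the successive differences of a solution of the perturbed recurrence
`x (n + 5) = p x (n + 4) + q x n + f n` with `p + q = 1` decay geometrically. -/
theorem norm_succ_sub_le_of_recurrence (hpq : p + q = 1) (hq : ‖q‖ ≤ 0.246)
    (hx : ∀ n, x (n + 5) = p * x (n + 4) + q * x n + f n)
    (hf : ∀ n, ‖f n‖ ≤ D / 100 * 0.999 ^ n)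
    (h0 : ∀ i < 4, ‖x (i + 1) - x i‖ ≤ D * 0.999 ^ i) (n : ℕ) :
    ‖x (n + 1) - x n‖ ≤ D * 0.999 ^ n := by
  have hD : 0 ≤ D := by simpa using (norm_nonneg _).trans (h0 0 (by norm_num))
  induction n using Nat.strong_induction_on with
  | _ n ih =>
    obtain hn | ⟨n, rfl⟩ : n < 4 ∨ ∃ m, n = m + 4 := by
      by_cases h : n < 4
      · exact .inl h
      · exact .inr ⟨n - 4, by omega⟩
    · exact h0 n hn
    -- As p - 1 = -q, the new difference is -q(x(n+4) - x(n)) + f(n), and the bracket telescopes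
    -- into four earlier differences.
    have hd : x (n + 4 + 1) - x (n + 4) = -q * ((x (n + 1) - x n) + (x (n + 1 + 1) - x (n + 1)) +
        (x (n + 2 + 1) - x (n + 2)) + (x (n + 3 + 1) - x (n + 3))) + f n := by
      rw [hx]
      linear_combination x (n + 4) * hpq
    have hr : (0 : ℝ) ≤ D * 0.999 ^ n := by positivity
    have hle : ∀ i, D * (0.999 : ℝ) ^ (n + i) ≤ D * 0.999 ^ n := fun i => by
      refine mul_le_mul_of_nonneg_left ?_ hD
      exact pow_le_pow_of_le_one (by norm_num) (by norm_num) (by omega)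
    have h1 := ih n (by omega)
    have h2 := (ih (n + 1) (by omega)).trans (hle 1)
    have h3 := (ih (n + 2) (by omega)).trans (hle 2)
    have h4 := (ih (n + 3) (by omega)).trans (hle 3)
    have hs : ‖(x (n + 1) - x n) + (x (n + 1 + 1) - x (n + 1)) +
        (x (n + 2 + 1) - x (n + 2)) + (x (n + 3 + 1) - x (n + 3))‖ ≤ 4 * (D * 0.999 ^ n) :=
      norm_add₄_le.trans (by linarith)
    calc ‖x (n + 4 + 1) - x (n + 4)‖
        ≤ 0.246 * (4 * (D * 0.999 ^ n)) + D / 100 * 0.999 ^ n := by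
          rw [hd]
          refine (norm_add_le _ _).trans (add_le_add ?_ (hf n))
          rw [norm_mul, norm_neg]
          exact mul_le_mul hq hs (norm_nonneg _) (by norm_num)
      -- The rate 0.999 fits because 4 · 0.246 + 0.01 = 0.994 < 0.999^4.
      _ ≤ D * 0.999 ^ (n + 4) := by
          rw [pow_add, ← mul_assoc]
          linarith

theorem GeomDecay.of_recurrence (hpq : p + q = 1) (hq : ‖q‖ ≤ 0.246)
    (hx : ∀ n, x (n + 5) = p * x (n + 4) + q * x n + f n) (hf : GeomDecay f) :
    GeomDecay fun n => x (n + 1) - x n := by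
  obtain ⟨C, hC⟩ := hf
  have hr : (0 : ℝ) < 0.999 := by norm_num
  -- The term 100C absorbs the forcing, which may be at most D/100; the sum covers the four initial
  -- differences.
  refine ⟨100 * C + ∑ i ∈ Finset.range 4, ‖x (i + 1) - x i‖ / 0.999 ^ i,
    norm_succ_sub_le_of_recurrence hpq hq hx (fun n => (hC n).trans ?_) fun i hi => ?_⟩
  · refine mul_le_mul_of_nonneg_right ?_ (by positivity)
    have : 0 ≤ ∑ i ∈ Finset.range 4, ‖x (i + 1) - x i‖ / (0.999 : ℝ) ^ i := by positivity
    linarith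
  · rw [← div_le_iff₀ (by positivity)]
    have hC0 : 0 ≤ C := by simpa using (norm_nonneg _).trans (hC 0)
    have := Finset.single_le_sum (f := fun i => ‖x (i + 1) - x i‖ / (0.999 : ℝ) ^ i)
      (fun _ _ => by positivity) (Finset.mem_range.2 hi)
    linarith

theorem GeomDecay.bounded (h : GeomDecay fun n => x (n + 1) - x n) :
    ∃ B : ℝ, ∀ n, ‖x n‖ ≤ B := by
  obtain ⟨C, hC⟩ := h
  have hC0 : 0 ≤ C := by simpa using (norm_nonneg _).trans (hC 0)
  -- Partial sums of the geometric series, with 1000 = 1/(1 - 0.999).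
  have key : ∀ n, ‖x n‖ ≤ ‖x 0‖ + 1000 * C * (1 - 0.999 ^ n) := fun n => by
    induction n with
    | zero => simp
    | succ n ih =>
      have h1 := norm_add_le (x n) (x (n + 1) - x n)
      rw [add_sub_cancel] at h1
      rw [pow_succ]
      linarith [hC n]
  refine ⟨‖x 0‖ + 1000 * C, fun n => (key n).trans ?_⟩
  have : 0 ≤ 1000 * C * (0.999 : ℝ) ^ n := by positivity
  linarith

end Recurrence

/-! ### Scaled moments, and the asymptotics of mean and variance. -/

/-- The `j`-th moment of `K_n` about `C₁ n`, multiplied by `Z_n / λ ^ n`. -/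
noncomputable def scaledMoment (j n : ℕ) : ℝ :=
  countSum (fun k => ((k : ℝ) - meanConst * n) ^ j) n / plasticRatio ^ n

theorem countSum_linear_comb (a b c : ℝ) (f g h : ℕ → ℝ) (n : ℕ) :
    countSum (fun k => a * f k + b * g k + c * h k) n =
      a * countSum f n + b * countSum g n + c * countSum h n := by
  simp only [countSum, Finset.sum_add_distrib, Finset.mul_sum]

theorem scaledMoment_zero_add_five (n : ℕ) :
    scaledMoment 0 (n + 5) = 1 / plasticRatio * scaledMoment 0 (n + 4) +
      1 / plasticRatio ^ 5 * scaledMoment 0 n := by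
  have h := plasticRatio_pos
  simp only [scaledMoment, pow_zero, countSum_add_five]
  field_simp
  ring

/-- Moving the centre to C₁(n+5) shifts the count by -C₁ on the first block and by 1 - 5C₁ on the
second, whose numbers have one more summand. -/
theorem scaledMoment_one_add_five (n : ℕ) :
    scaledMoment 1 (n + 5) =
      1 / plasticRatio * (scaledMoment 1 (n + 4) - meanConst * scaledMoment 0 (n + 4)) +
      1 / plasticRatio ^ 5 * (scaledMoment 1 n + (1 - 5 * meanConst) * scaledMoment 0 n) := by
  have h := plasticRatio_pos
  have h1 := countSum_linear_comb 1 (-meanConst) 0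
    (fun k => ((k : ℝ) - meanConst * (n + 4 : ℕ)) ^ 1)
    (fun k => ((k : ℝ) - meanConst * (n + 4 : ℕ)) ^ 0) (fun _ => 0) (n + 4)
  have h2 := countSum_linear_comb 1 (1 - 5 * meanConst) 0
    (fun k => ((k : ℝ) - meanConst * n) ^ 1)
    (fun k => ((k : ℝ) - meanConst * n) ^ 0) (fun _ => 0) n
  have h3 : countSum (fun k => ((k : ℝ) - meanConst * (n + 5 : ℕ)) ^ 1) (n + 5) = _ :=
    (countSum_add_five _ n).trans (congrArg₂ (· + ·)
      ((congrArg (countSum · (n + 4)) (by ext k; push_cast; ring)).trans h1)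
      ((congrArg (countSum · n) (by ext k; push_cast; ring)).trans h2))
  simp only [scaledMoment, h3]
  field_simp
  ring

theorem scaledMoment_two_add_five (n : ℕ) :
    scaledMoment 2 (n + 5) =
      1 / plasticRatio * (scaledMoment 2 (n + 4) - 2 * meanConst * scaledMoment 1 (n + 4) +
        meanConst ^ 2 * scaledMoment 0 (n + 4)) +
      1 / plasticRatio ^ 5 * (scaledMoment 2 n + 2 * (1 - 5 * meanConst) * scaledMoment 1 n +
        (1 - 5 * meanConst) ^ 2 * scaledMoment 0 n) := by
  have h := plasticRatio_pos
  have h1 := countSum_linear_comb 1 (-2 * meanConst) (meanConst ^ 2)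
    (fun k => ((k : ℝ) - meanConst * (n + 4 : ℕ)) ^ 2)
    (fun k => ((k : ℝ) - meanConst * (n + 4 : ℕ)) ^ 1)
    (fun k => ((k : ℝ) - meanConst * (n + 4 : ℕ)) ^ 0) (n + 4)
  have h2 := countSum_linear_comb 1 (2 * (1 - 5 * meanConst)) ((1 - 5 * meanConst) ^ 2)
    (fun k => ((k : ℝ) - meanConst * n) ^ 2)
    (fun k => ((k : ℝ) - meanConst * n) ^ 1)
    (fun k => ((k : ℝ) - meanConst * n) ^ 0) n
  have h3 : countSum (fun k => ((k : ℝ) - meanConst * (n + 5 : ℕ)) ^ 2) (n + 5) = _ :=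
    (countSum_add_five _ n).trans (congrArg₂ (· + ·)
      ((congrArg (countSum · (n + 4)) (by ext k; push_cast; ring)).trans h1)
      ((congrArg (countSum · n) (by ext k; push_cast; ring)).trans h2))
  simp only [scaledMoment, h3]
  field_simp
  ring

theorem one_div_plasticRatio_add : 1 / plasticRatio + 1 / plasticRatio ^ 5 = 1 := by
  have h := plasticRatio_pos
  field_simp
  linear_combination -plasticRatio_pow_five

/-- The value is about 0.2451; the bound 0.246 leaves room on both sides, for perturbing z here and
for staying below 1/4. -/
theorem one_div_plasticRatio_pow_five_lt : 1 / plasticRatio ^ 5 < 0.246 := by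
  have h := plasticRatio_gt
  have h5 : (1.3247179 : ℝ) ^ 5 < plasticRatio ^ 5 := pow_lt_pow_left₀ h (by norm_num) (by norm_num)
  rw [div_lt_iff₀ (by positivity)]
  norm_num at h5 ⊢
  linarith

/-- This equation determines C₁: it turns the forcing in the first-moment recurrence into a multiple
of a difference of zeroth moments, which decays. -/
theorem meanConst_balance : 1 / plasticRatio ^ 5 * (1 - 5 * meanConst) =
    1 / plasticRatio * meanConst := by
  have h := plasticRatio_pos
  rw [meanConst_eq]
  field_simp
  ring

/-- This equation determines C₂. The factors 1 and 5 are the index jumps from n+4 and n to n+5,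
which is how the subtracted term C₂n changes. -/
theorem varConst_balance : varConst * (1 / plasticRatio + 5 * (1 / plasticRatio ^ 5)) =
    1 / plasticRatio * meanConst ^ 2 + 1 / plasticRatio ^ 5 * (1 - 5 * meanConst) ^ 2 := by
  have h := plasticRatio_pos
  rw [meanConst_eq, varConst_eq]
  field_simp
  linear_combination (plasticRatio ^ 4) * plasticRatio_pow_five

theorem norm_one_div_plasticRatio_pow_five_le : ‖1 / plasticRatio ^ 5‖ ≤ 0.246 := by
  have h := plasticRatio_pos
  rw [Real.norm_of_nonneg (by positivity)]
  exact one_div_plasticRatio_pow_five_lt.le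

theorem geomDecay_scaledMoment_zero :
    GeomDecay fun n => scaledMoment 0 (n + 1) - scaledMoment 0 n :=
  .of_recurrence (f := fun _ => 0) one_div_plasticRatio_add norm_one_div_plasticRatio_pow_five_le
    (fun n => by rw [scaledMoment_zero_add_five, add_zero]) ⟨0, by simp⟩

theorem geomDecay_scaledMoment_one :
    GeomDecay fun n => scaledMoment 1 (n + 1) - scaledMoment 1 n := by
  refine .of_recurrence one_div_plasticRatio_add norm_one_div_plasticRatio_pow_five_le
    (fun n => ?_)
    (geomDecay_scaledMoment_zero.sub_add_four.const_mul (-(1 / plasticRatio * meanConst)))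
  rw [scaledMoment_one_add_five]
  linear_combination scaledMoment 0 n * meanConst_balance

/-- The centred second moment with its linear growth removed. -/
noncomputable def secondMomentDefect (n : ℕ) : ℝ :=
  scaledMoment 2 n - varConst * n * scaledMoment 0 n

theorem geomDecay_secondMomentDefect :
    GeomDecay fun n => secondMomentDefect (n + 1) - secondMomentDefect n := by
  refine .of_recurrence one_div_plasticRatio_add norm_one_div_plasticRatio_pow_five_le
    (fun n => ?_)
    ((geomDecay_scaledMoment_zero.sub_add_four.const_mul
      (1 / plasticRatio * meanConst ^ 2 - 1 / plasticRatio * varConst)).add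
      (geomDecay_scaledMoment_one.sub_add_four.const_mul (-2 * (1 / plasticRatio * meanConst))))
  simp only [secondMomentDefect]
  rw [scaledMoment_two_add_five, scaledMoment_zero_add_five]
  push_cast
  linear_combination 2 * scaledMoment 1 n * meanConst_balance -
    scaledMoment 0 n * varConst_balance

/-- Each term is a convex combination of earlier ones, so a lower bound on the first five persists;
there Z_n ≥ 1 and λ^n ≤ λ^4. -/
theorem one_div_le_scaledMoment_zero (n : ℕ) :
    1 / plasticRatio ^ 4 ≤ scaledMoment 0 n := by
  have h := plasticRatio_pos
  have h1 : 1 ≤ plasticRatio := by linarith [plasticRatio_gt]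
  induction n using Nat.strong_induction_on with
  | _ n ih =>
    obtain hn | ⟨n, rfl⟩ : n ≤ 4 ∨ ∃ m, n = m + 5 := by
      by_cases h : n ≤ 4
      · exact .inl h
      · exact .inr ⟨n - 5, by omega⟩
    · have : (1 : ℝ) ≤ lagonacci n := by exact_mod_cast lagonacci_pos n
      simp only [scaledMoment, pow_zero, countSum, Finset.sum_const, Finset.card_range,
        nsmul_eq_mul, mul_one]
      exact div_le_div₀ (by positivity) this (by positivity) (pow_le_pow_right₀ h1 hn)
    · have a := mul_le_mul_of_nonneg_left (ih (n + 4) (by omega)) (one_div_pos.2 h).le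
      have b := mul_le_mul_of_nonneg_left (ih n (by omega)) (one_div_pos.2 (pow_pos h 5)).le
      rw [scaledMoment_zero_add_five]
      refine le_of_eq_of_le ?_ (add_le_add a b)
      rw [← add_mul, one_div_plasticRatio_add, one_mul]

theorem scaledMoment_zero_pos (n : ℕ) : 0 < scaledMoment 0 n :=
  (one_div_pos.2 (pow_pos plasticRatio_pos 4)).trans_le (one_div_le_scaledMoment_zero n)

theorem scaledMoment_zero_eq (n : ℕ) : scaledMoment 0 n = lagonacci n / plasticRatio ^ n := by
  simp [scaledMoment, countSum]

theorem integral_pow_sub_uniformBelow (j n : ℕ) :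
    ∫ m, (summandCount m - meanConst * n) ^ j ∂(uniformBelow n) =
      scaledMoment j n / scaledMoment 0 n := by
  have h := pow_pos plasticRatio_pos n
  have hZ : (0 : ℝ) < lagonacci n := by exact_mod_cast lagonacci_pos n
  have := integral_uniformBelow (fun k : ℕ => ((k : ℝ) - meanConst * n) ^ j) n
  simp only [summandCount]
  rw [this, scaledMoment_zero_eq, scaledMoment, smul_eq_mul]
  field_simp

theorem meanK_sub (n : ℕ) :
    meanK n - meanConst * n = scaledMoment 1 n / scaledMoment 0 n := by
  rw [← integral_pow_sub_uniformBelow, meanK]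
  simp only [pow_one]
  rw [integral_sub (integrable_uniformBelow _ _) (integrable_uniformBelow _ _)]
  simp

theorem varK_sub (n : ℕ) :
    varK n - varConst * n =
      secondMomentDefect n / scaledMoment 0 n - (scaledMoment 1 n / scaledMoment 0 n) ^ 2 := by
  have h0 := (scaledMoment_zero_pos n).ne'
  have hL : MemLp (fun m => summandCount m - meanConst * n) 2 (uniformBelow n) :=
    (memLp_two_iff_integrable_sq (integrable_uniformBelow _ _).1).2 (integrable_uniformBelow _ _)
  have h1 := integral_pow_sub_uniformBelow 1 n
  simp only [pow_one] at h1
  -- Variance is translation invariant, so it may be computed from the moments about C₁n.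
  rw [varK, ← variance_sub_const (integrable_uniformBelow _ _).1 (meanConst * n),
    variance_eq_sub hL]
  simp only [Pi.pow_apply]
  rw [integral_pow_sub_uniformBelow, h1, secondMomentDefect]
  field_simp
  ring

theorem isBigO_one_div_scaledMoment_zero {x : ℕ → ℝ} {B : ℝ} (h : ∀ n, ‖x n‖ ≤ B) :
    (fun n => x n / scaledMoment 0 n) =O[atTop] fun _ => (1 : ℝ) := by
  have hp : 0 < 1 / plasticRatio ^ 4 := one_div_pos.2 (pow_pos plasticRatio_pos 4)
  refine .of_bound (B / (1 / plasticRatio ^ 4)) (.of_forall fun n => ?_)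
  rw [norm_div, Real.norm_of_nonneg (scaledMoment_zero_pos n).le, norm_one, mul_one]
  exact div_le_div₀ ((norm_nonneg _).trans (h n)) (h n) hp (one_div_le_scaledMoment_zero n)

theorem meanK_sub_isBigO :
    (fun N : ℕ => meanK N - meanConst * N) =O[atTop] fun _ => (1 : ℝ) := by
  obtain ⟨B, hB⟩ := geomDecay_scaledMoment_one.bounded
  simp only [meanK_sub]
  exact isBigO_one_div_scaledMoment_zero hB

theorem varK_sub_isBigO :
    (fun N : ℕ => varK N - varConst * N) =O[atTop] fun _ => (1 : ℝ) := by
  obtain ⟨B, hB⟩ := geomDecay_secondMomentDefect.bounded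
  have h := (isBigO_one_div_scaledMoment_zero hB).sub
    ((meanK_sub_isBigO.mul meanK_sub_isBigO).congr_right fun _ => mul_one 1)
  refine h.congr_left fun n => ?_
  rw [varK_sub, meanK_sub, sq]

/-! ### The generating function near z = 0. -/

/-- The dominant root `λ e^z` of `x ^ 5 = x ^ 4 + t`, where `t = rootWeight z`. -/
noncomputable def dominantRoot (z : ℂ) : ℂ := plasticRatio * Complex.exp z

/-- The weight `t` for which `λ e^z` is a root of `x ^ 5 = x ^ 4 + t`. -/
noncomputable def rootWeight (z : ℂ) : ℂ := dominantRoot z ^ 5 - dominantRoot z ^ 4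

/-- The generating function of `k` on `[0, Z_n)` at `t = rootWeight z`, divided by its
exponential growth `(λ e^z) ^ n`. -/
noncomputable def scaledGenFun (n : ℕ) (z : ℂ) : ℂ :=
  countSum (fun k => rootWeight z ^ k) n / dominantRoot z ^ n

theorem dominantRoot_ne_zero (z : ℂ) : dominantRoot z ≠ 0 :=
  mul_ne_zero (by exact_mod_cast plasticRatio_pos.ne') (Complex.exp_ne_zero z)

theorem dominantRoot_zero : dominantRoot 0 = plasticRatio := by simp [dominantRoot]

theorem rootWeight_zero : rootWeight 0 = 1 := by
  rw [rootWeight, dominantRoot_zero]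
  have : (plasticRatio : ℂ) ^ 5 = plasticRatio ^ 4 + 1 := by exact_mod_cast plasticRatio_pow_five
  linear_combination this

@[fun_prop]
theorem continuous_dominantRoot : Continuous dominantRoot := by
  unfold dominantRoot; fun_prop

@[fun_prop]
theorem continuous_rootWeight : Continuous rootWeight := by
  unfold rootWeight; fun_prop

@[fun_prop]
theorem continuous_scaledGenFun (n : ℕ) : Continuous (scaledGenFun n) := by
  unfold scaledGenFun countSum
  exact Continuous.div (by fun_prop) (by fun_prop) fun z => pow_ne_zero _ (dominantRoot_ne_zero z)

theorem one_div_dominantRoot_add (z : ℂ) :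
    1 / dominantRoot z + rootWeight z / dominantRoot z ^ 5 = 1 := by
  have := dominantRoot_ne_zero z
  rw [rootWeight]
  field_simp
  ring

theorem scaledGenFun_add_five (n : ℕ) (z : ℂ) :
    scaledGenFun (n + 5) z = 1 / dominantRoot z * scaledGenFun (n + 4) z +
      rootWeight z / dominantRoot z ^ 5 * scaledGenFun n z := by
  have h := dominantRoot_ne_zero z
  have h1 : countSum (fun k => rootWeight z ^ (k + 1)) n =
      rootWeight z * countSum (fun k => rootWeight z ^ k) n := by
    simp only [countSum, Finset.mul_sum, pow_succ']
  simp only [scaledGenFun, countSum_add_five, h1]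
  field_simp
  ring

theorem scaledGenFun_zero (n : ℕ) : scaledGenFun n 0 = (scaledMoment 0 n : ℝ) := by
  simp [scaledGenFun, rootWeight_zero, dominantRoot_zero, scaledMoment_zero_eq, countSum]

/-- A linear functional of five consecutive terms that the recurrence preserves. -/
theorem scaledGenFun_invariant (n : ℕ) (z : ℂ) :
    scaledGenFun (n + 4) z + rootWeight z / dominantRoot z ^ 5 *
      (scaledGenFun n z + scaledGenFun (n + 1) z + scaledGenFun (n + 2) z +
        scaledGenFun (n + 3) z) =
    scaledGenFun 4 z + rootWeight z / dominantRoot z ^ 5 *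
      (scaledGenFun 0 z + scaledGenFun 1 z + scaledGenFun 2 z + scaledGenFun 3 z) := by
  induction n with
  | zero => simp
  | succ n ih =>
    rw [← ih, show n + 1 + 4 = n + 5 by ring, scaledGenFun_add_five]
    simp only [show n + 1 + 1 = n + 2 by ring, show n + 1 + 2 = n + 3 by ring,
      show n + 1 + 3 = n + 4 by ring]
    linear_combination scaledGenFun (n + 4) z * one_div_dominantRoot_add z

theorem continuous_rootWeight_div :
    Continuous fun z => rootWeight z / dominantRoot z ^ 5 :=
  Continuous.div (by fun_prop) (by fun_prop) fun z => pow_ne_zero _ (dominantRoot_ne_zero z)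

theorem norm_rootWeight_div_zero_lt : ‖rootWeight 0 / dominantRoot 0 ^ 5‖ < 0.246 := by
  rw [rootWeight_zero, dominantRoot_zero]
  have h := one_div_plasticRatio_pow_five_lt
  have := plasticRatio_pos
  simpa [abs_of_pos this] using h

/-- The contraction is uniform near 0: |q(0)| < 0.246 is an open condition, and the `+ 1` in `D`
gives the four initial differences room to vary with z. -/
theorem exists_norm_scaledGenFun_sub_le : ∃ D : ℝ, ∀ᶠ z in 𝓝 (0 : ℂ),
    ∀ n, ‖scaledGenFun (n + 1) z - scaledGenFun n z‖ ≤ D * 0.999 ^ n := by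
  let D : ℝ := ∑ i ∈ Finset.range 4,
    (‖scaledGenFun (i + 1) 0 - scaledGenFun i 0‖ + 1) / 0.999 ^ i
  have hD0 : 0 ≤ D := Finset.sum_nonneg fun i _ => by positivity
  refine ⟨D, ?_⟩
  have h1 : ∀ᶠ z in 𝓝 (0 : ℂ), ∀ i ∈ Finset.range 4,
      ‖scaledGenFun (i + 1) z - scaledGenFun i z‖ ≤ D * 0.999 ^ i := by
    rw [eventually_all_finset]
    intro i hi
    have hc : Continuous fun z => ‖scaledGenFun (i + 1) z - scaledGenFun i z‖ := by fun_prop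
    have hle := Finset.single_le_sum
      (f := fun i => (‖scaledGenFun (i + 1) 0 - scaledGenFun i 0‖ + 1) / (0.999 : ℝ) ^ i)
      (fun _ _ => by positivity) hi
    rw [div_le_iff₀ (by positivity)] at hle
    filter_upwards [hc.continuousAt.eventually_lt_const (lt_add_one _)] with z hz
    exact hz.le.trans hle
  filter_upwards [h1,
    continuous_rootWeight_div.norm.continuousAt.eventually_lt_const norm_rootWeight_div_zero_lt]
    with z hz hq
  exact norm_succ_sub_le_of_recurrence (x := fun n => scaledGenFun n z) (f := fun _ => 0)
    (one_div_dominantRoot_add z) hq.le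
    (fun n => by simp only [scaledGenFun_add_five, add_zero])
    (fun n => by rw [norm_zero]; positivity) fun i hi => hz i (Finset.mem_range.2 hi)

/-- The scaled generating functions converge to a nonzero limit, locally uniformly at `0`. -/
theorem exists_tendsto_scaledGenFun : ∃ L : ℂ, L ≠ 0 ∧
    ∀ z : ℕ → ℂ, Tendsto z atTop (𝓝 0) →
      Tendsto (fun n => scaledGenFun n (z n)) atTop (𝓝 L) := by
  let q : ℂ → ℂ := fun z => rootWeight z / dominantRoot z ^ 5
  let B : ℂ → ℂ := fun z => scaledGenFun 4 z + q z *
      (scaledGenFun 0 z + scaledGenFun 1 z + scaledGenFun 2 z + scaledGenFun 3 z)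
  have hqc : Continuous q := continuous_rootWeight_div
  have hBc : Continuous B := by fun_prop
  have hq0 : ‖q 0‖ < 0.246 := norm_rootWeight_div_zero_lt
  have hne : 1 + 4 * q 0 ≠ 0 := fun h => by
    have h1 : ‖4 * q 0‖ = 1 := by
      rw [eq_neg_of_add_eq_zero_right h]; simp
    rw [norm_mul] at h1
    norm_num at h1
    linarith
  -- If the scaled terms settle at a value L, the invariant reads L(1 + 4q) = B, which dictates the
  -- limit.
  have main : ∀ z : ℕ → ℂ, Tendsto z atTop (𝓝 0) →
      Tendsto (fun n => scaledGenFun n (z n)) atTop (𝓝 (B 0 / (1 + 4 * q 0))) := by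
    intro z hz
    rw [← tendsto_add_atTop_iff_nat 4]
    replace hz : Tendsto (fun n => z (n + 4)) atTop (𝓝 0) := (tendsto_add_atTop_iff_nat 4).2 hz
    obtain ⟨D, hD⟩ := exists_norm_scaledGenFun_sub_le
    have hq : Tendsto (fun n => 1 + 4 * q (z (n + 4))) atTop (𝓝 (1 + 4 * q 0)) :=
      ((by fun_prop : Continuous fun w => 1 + 4 * q w).tendsto 0).comp hz
    have hB : Tendsto (fun n => B (z (n + 4))) atTop (𝓝 (B 0)) := (hBc.tendsto 0).comp hz
    have hdiff : Tendsto (fun n => scaledGenFun (n + 4) (z (n + 4)) * (1 + 4 * q (z (n + 4))) -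
        B (z (n + 4))) atTop (𝓝 0) := by
      have hgeo : Tendsto (fun n : ℕ => 10 * D * (0.999 : ℝ) ^ n) atTop (𝓝 0) := by
        simpa using (tendsto_pow_atTop_nhds_zero_of_lt_one (r := (0.999 : ℝ)) (by norm_num)
          (by norm_num)).const_mul (10 * D)
      refine squeeze_zero_norm' ?_ hgeo
      filter_upwards [hz.eventually hD,
        hz.eventually (hqc.norm.continuousAt.eventually_lt_const hq0)] with n hn hqn
      have hD0 : 0 ≤ D := by simpa using (norm_nonneg _).trans (hn 0)
      set w := z (n + 4)
      have hle : ∀ i, ‖scaledGenFun (n + i + 1) w - scaledGenFun (n + i) w‖ ≤ D * 0.999 ^ n :=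
        fun i => (hn _).trans <| mul_le_mul_of_nonneg_left
          (pow_le_pow_of_le_one (by norm_num) (by norm_num) (by omega)) hD0
      -- Each gap from term n+j to term n+4 telescopes; collecting the gaps for j = 0, …, 3 gives
      -- weights 1, 2, 3, 4, whence the factor 10 in `hgeo`.
      have key : scaledGenFun (n + 4) w * (1 + 4 * q w) - B w = q w *
          ((scaledGenFun (n + 0 + 1) w - scaledGenFun (n + 0) w) +
            2 * (scaledGenFun (n + 1 + 1) w - scaledGenFun (n + 1) w) +
            3 * (scaledGenFun (n + 2 + 1) w - scaledGenFun (n + 2) w) +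
            4 * (scaledGenFun (n + 3 + 1) w - scaledGenFun (n + 3) w)) := by
        have := scaledGenFun_invariant n w
        simp only [B, q, add_zero, add_assoc, Nat.reduceAdd] at this ⊢
        linear_combination this
      have hmul : ∀ (c : ℝ) (i : ℕ), 0 ≤ c →
          ‖(c : ℂ) * (scaledGenFun (n + i + 1) w - scaledGenFun (n + i) w)‖ ≤
            c * (D * 0.999 ^ n) := fun c i hc => by
        rw [norm_mul, Complex.norm_of_nonneg hc]
        exact mul_le_mul_of_nonneg_left (hle i) hc
      have h2 := hmul 2 1 (by norm_num)
      have h3 := hmul 3 2 (by norm_num)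
      have h4 := hmul 4 3 (by norm_num)
      push_cast at h2 h3 h4
      have hs := (norm_add₄_le).trans (add_le_add (add_le_add (add_le_add (hle 0) h2) h3) h4)
      rw [key, norm_mul]
      calc _ ≤ 1 * _ := mul_le_mul (by linarith) hs (norm_nonneg _) zero_le_one
        _ = _ := by ring
    have := (hdiff.add hB).div hq hne
    rw [zero_add] at this
    refine this.congr' ?_
    filter_upwards [hq.eventually_ne hne] with n hn
    simp only [Pi.div_apply, sub_add_cancel]
    exact mul_div_cancel_right₀ _ hn
  -- The limit is the same for every sequence, so z = 0 suffices; there the terms are the zeroth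
  -- moments, bounded away from 0.
  refine ⟨_, fun h0 => ?_, main⟩
  have hpos : 0 < 1 / plasticRatio ^ 4 := one_div_pos.2 (pow_pos plasticRatio_pos 4)
  have hlim := (main (fun _ => 0) tendsto_const_nhds).norm
  have := ge_of_tendsto' hlim (b := 1 / plasticRatio ^ 4) fun n => by
    rw [scaledGenFun_zero, Complex.norm_of_nonneg (scaledMoment_zero_pos n).le]
    exact one_div_le_scaledMoment_zero n
  rw [h0, norm_zero] at this
  linarith

/-! ### Second-order expansion of the root in terms of w = log t. -/

theorem exp_sub_quadratic_isLittleO :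
    (fun w : ℂ => Complex.exp w - (1 + w + w ^ 2 / 2)) =o[𝓝 0] fun w => w ^ 2 := by
  simpa [Finset.sum_range_succ, Nat.factorial] using Complex.exp_sub_sum_range_succ_isLittleO_pow 2

theorem rootWeight_eq (z : ℂ) : rootWeight z =
    plasticRatio ^ 5 * Complex.exp (5 * z) - plasticRatio ^ 4 * Complex.exp (4 * z) := by
  rw [rootWeight, dominantRoot, mul_pow, mul_pow, ← Complex.exp_nat_mul, ← Complex.exp_nat_mul]
  norm_num

/-- The derivative of `rootWeight` at `0` is `1 / C₁`. -/
theorem hasStrictDerivAt_rootWeight :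
    HasStrictDerivAt rootWeight ((plasticRatio ^ 4 + 5 : ℝ) : ℂ) 0 := by
  have h5 : (plasticRatio : ℂ) ^ 5 = plasticRatio ^ 4 + 1 := by exact_mod_cast plasticRatio_pow_five
  have h : ∀ c : ℂ, HasStrictDerivAt (fun z : ℂ => Complex.exp (c * z)) c 0 := fun c => by
    simpa using ((hasStrictDerivAt_id (0 : ℂ)).const_mul c).cexp
  have := ((h 5).const_mul ((plasticRatio : ℂ) ^ 5)).sub
    ((h 4).const_mul ((plasticRatio : ℂ) ^ 4))
  rw [funext rootWeight_eq]
  convert! this using 1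
  push_cast
  linear_combination -5 * h5

/-- The coefficients are 5λ^5 - 4λ^4 = λ^4 + 5 and 25λ^5 - 16λ^4 = 9λ^4 + 25. -/
theorem rootWeight_sub_quadratic_isLittleO :
    (fun z : ℂ => rootWeight z - (1 + (plasticRatio ^ 4 + 5) * z +
      (9 * plasticRatio ^ 4 + 25) * z ^ 2 / 2)) =o[𝓝 0] fun z => z ^ 2 := by
  have h5 : (plasticRatio : ℂ) ^ 5 = plasticRatio ^ 4 + 1 := by exact_mod_cast plasticRatio_pow_five
  have h : ∀ c : ℂ, (fun z : ℂ => Complex.exp (c * z) - (1 + c * z + (c * z) ^ 2 / 2))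
      =o[𝓝 0] fun z => z ^ 2 := fun c => by
    have ht : Tendsto (fun z : ℂ => c * z) (𝓝 0) (𝓝 0) := by
      simpa using (continuous_const_mul c).tendsto 0
    refine (exp_sub_quadratic_isLittleO.comp_tendsto ht).trans_isBigO ?_
    refine .of_bound (‖c‖ ^ 2) (.of_forall fun z => ?_)
    simp [mul_pow]
  refine (((h 5).const_mul_left ((plasticRatio : ℂ) ^ 5)).sub
    ((h 4).const_mul_left ((plasticRatio : ℂ) ^ 4))).congr_left fun z => ?_
  rw [rootWeight_eq]
  linear_combination (-1 - 5 * z - 25 / 2 * z ^ 2) * h5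

/-- The local solution `h` of `rootWeight (h w) = exp w`, expanded to second order. -/
theorem exists_rootWeight_eq_exp : ∃ h : ℂ → ℂ, Tendsto h (𝓝 0) (𝓝 0) ∧
    (∀ᶠ w in 𝓝 0, rootWeight (h w) = Complex.exp w) ∧
    (fun w => h w - (meanConst * w + varConst * w ^ 2 / 2)) =o[𝓝 0] fun w => w ^ 2 := by
  have hl := plasticRatio_pos
  set a : ℂ := ((plasticRatio ^ 4 + 5 : ℝ) : ℂ) with ha_def
  have ha : a ≠ 0 := by
    rw [ha_def, Complex.ofReal_ne_zero]; positivity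
  let g := hasStrictDerivAt_rootWeight.localInverse rootWeight a 0 ha
  have hg : HasStrictDerivAt g a⁻¹ (rootWeight 0) :=
    hasStrictDerivAt_rootWeight.to_localInverse ha
  have hg0 : g (rootWeight 0) = 0 :=
    (HasStrictDerivAt.eventually_left_inverse hasStrictDerivAt_rootWeight ha).self_of_nhds
  have hgr : ∀ᶠ t in 𝓝 (rootWeight 0), rootWeight (g t) = t :=
    HasStrictDerivAt.eventually_right_inverse hasStrictDerivAt_rootWeight ha
  rw [rootWeight_zero] at hg hg0 hgr
  have hexp : Tendsto Complex.exp (𝓝 0) (𝓝 1) := by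
    simpa using Complex.continuous_exp.tendsto 0
  have hh : HasDerivAt (fun w => g (Complex.exp w)) a⁻¹ 0 := by
    have h1 : HasDerivAt g a⁻¹ (Complex.exp 0) := by rw [Complex.exp_zero]; exact hg.hasDerivAt
    simpa [Function.comp_def] using h1.comp 0 (Complex.hasDerivAt_exp 0)
  let h := fun w => g (Complex.exp w)
  have ht : Tendsto h (𝓝 0) (𝓝 0) := by simpa [h, hg0] using hh.continuousAt.tendsto
  have heq : ∀ᶠ w in 𝓝 0, rootWeight (h w) = Complex.exp w := hexp.eventually hgr
  refine ⟨h, ht, heq, ?_⟩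
  have hlin : (fun w => h w - a⁻¹ * w) =o[𝓝 0] fun w => w := by
    have := hasDerivAt_iff_isLittleO.1 hh
    simpa [h, hg0, mul_comm] using this
  have hO : h =O[𝓝 0] fun w => w := by
    have := hlin.isBigO.add (isBigO_const_mul_self a⁻¹ (fun w : ℂ => w) (𝓝 0))
    simpa using this
  have hsq : (fun w => h w ^ 2 - (a⁻¹ * w) ^ 2) =o[𝓝 0] fun w => w ^ 2 := by
    refine (hlin.mul_isBigO (hO.add (isBigO_const_mul_self a⁻¹ (fun w : ℂ => w) (𝓝 0)))).congr
      (fun w => ?_) (fun w => ?_) <;> ring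
  have hrho := (rootWeight_sub_quadratic_isLittleO.comp_tendsto ht).trans_isBigO (hO.pow 2)
  -- With a = λ^4 + 5 and b = 9λ^4 + 25, the two expansions give 1 + w + w²/2 = 1 + ah + bh²/2 +
  -- o(w²). Replacing h² by (w/a)² and dividing by a solves for h, with C₁ = 1/a and C₂ = (1 -
  -- b/a²)/a.
  have hfin := ((exp_sub_quadratic_isLittleO.sub hrho).sub
    (hsq.const_mul_left ((9 * plasticRatio ^ 4 + 25) / 2))).const_mul_left a⁻¹
  refine hfin.congr' ?_ .rfl
  filter_upwards [heq] with w hw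
  have hmean : (meanConst : ℂ) = a⁻¹ := by rw [meanConst_eq, ha_def]; push_cast; rw [one_div]
  have hvar : (varConst : ℂ) = a⁻¹ * (1 - (9 * plasticRatio ^ 4 + 25) * a⁻¹ ^ 2) := by
    have hr : varConst = (plasticRatio ^ 4 + 5)⁻¹ *
        (1 - (9 * plasticRatio ^ 4 + 25) * (plasticRatio ^ 4 + 5)⁻¹ ^ 2) := by
      rw [varConst_eq]
      field_simp
      linear_combination plasticRatio ^ 4 * plasticRatio_pow_five
    rw [hr, ha_def]; push_cast; rfl
  have hinv : a⁻¹ * (plasticRatio ^ 4 + 5) = 1 := by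
    have : (plasticRatio ^ 4 + 5 : ℂ) = a := by rw [ha_def]; push_cast; rfl
    rw [this, inv_mul_cancel₀ ha]
  simp only [Function.comp_apply, hw, hmean, hvar]
  linear_combination h w * hinv

/-! ### Characteristic functions and the normal limit. -/

theorem tendsto_varK_div : Tendsto (fun N : ℕ => varK N / N) atTop (𝓝 varConst) := by
  have h1 : Tendsto (fun N : ℕ => (N : ℝ)⁻¹) atTop (𝓝 0) := tendsto_inv_atTop_nhds_zero_nat
  have h2 : Tendsto (fun N : ℕ => (varK N - varConst * N) * (N : ℝ)⁻¹) atTop (𝓝 0) :=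
    (isLittleO_one_iff ℝ).1 ((varK_sub_isBigO.mul_isLittleO
      ((isLittleO_one_iff ℝ).2 h1)).congr_right fun _ => mul_one 1)
  have h3 := h2.add_const varConst
  rw [zero_add] at h3
  refine h3.congr' ?_
  filter_upwards [eventually_ne_atTop 0] with N hN
  field_simp
  ring

theorem varK_nonneg (N : ℕ) : 0 ≤ varK N := variance_nonneg _ _

theorem tendsto_nat_div_varK : Tendsto (fun N : ℕ => N / varK N) atTop (𝓝 varConst⁻¹) := by
  simpa using tendsto_varK_div.inv₀ varConst_pos.ne'

theorem tendsto_varK_atTop : Tendsto varK atTop atTop := by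
  refine (tendsto_varK_div.pos_mul_atTop varConst_pos tendsto_natCast_atTop_atTop).congr' ?_
  filter_upwards [eventually_ne_atTop 0] with N hN
  field_simp

/-- The expectation of t^k is F_N(t)/Z_N. Scaling the numerator by (λe^z)^N and the denominator by
λ^N leaves only e^{Nz} outside the ratio. -/
theorem charFun_normalized (N : ℕ) (s : ℝ) (z : ℂ)
    (hz : rootWeight z = Complex.exp ((s / √(varK N) : ℝ) * Complex.I)) :
    charFun ((uniformBelow N).map fun m => (summandCount m - meanK N) / √(varK N)) s =
      Complex.exp (N * z - (s / √(varK N) : ℝ) * Complex.I * meanK N) *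
        (scaledGenFun N z / scaledGenFun N 0) := by
  rw [charFun_apply_real, integral_map (Measurable.of_discrete).aemeasurable (by fun_prop)]
  have h1 := integral_uniformBelow
    (fun k : ℕ => Complex.exp (s * ((k - meanK N) / √(varK N) : ℝ) * Complex.I)) N
  have h2 : countSum
      (fun k : ℕ => Complex.exp (s * ((k - meanK N) / √(varK N) : ℝ) * Complex.I)) N =
      Complex.exp (-((s / √(varK N) : ℝ) * Complex.I * meanK N)) *
        countSum (fun k => rootWeight z ^ k) N := by
    rw [hz]
    simp only [countSum, Finset.mul_sum, ← Complex.exp_nat_mul, ← Complex.exp_add]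
    refine Finset.sum_congr rfl fun m _ => congrArg _ ?_
    push_cast
    ring
  have hl : (plasticRatio : ℂ) ≠ 0 := by exact_mod_cast plasticRatio_pos.ne'
  have hZ : (lagonacci N : ℂ) ≠ 0 := by exact_mod_cast (lagonacci_pos N).ne'
  have he := Complex.exp_ne_zero z
  refine h1.trans ?_
  rw [h2, scaledGenFun_zero, scaledMoment_zero_eq, scaledGenFun, dominantRoot, sub_eq_add_neg,
    Complex.exp_add, Complex.exp_nat_mul, Complex.real_smul, mul_pow]
  push_cast
  field_simp

theorem tendsto_charFun_normalized (s : ℝ) :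
    Tendsto (fun N : ℕ => charFun ((uniformBelow N).map fun m =>
      (summandCount m - meanK N) / √(varK N)) s) atTop (𝓝 (Complex.exp ((-(s ^ 2 / 2) : ℝ) : ℂ))) := by
  obtain ⟨h, ht, heq, hexpand⟩ := exists_rootWeight_eq_exp
  obtain ⟨L, hL, hlim⟩ := exists_tendsto_scaledGenFun
  let θ : ℕ → ℝ := fun N => s / √(varK N)
  have hθ : Tendsto θ atTop (𝓝 0) :=
    (Real.tendsto_sqrt_atTop.comp tendsto_varK_atTop).const_div_atTop s
  let w : ℕ → ℂ := fun N => θ N * Complex.I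
  have hw : Tendsto w atTop (𝓝 0) := by
    simpa [w] using ((Complex.continuous_ofReal.tendsto 0).comp hθ).mul_const Complex.I
  have hzlim := ht.comp hw
  have hratio : Tendsto (fun N => scaledGenFun N (h (w N)) / scaledGenFun N 0) atTop (𝓝 1) := by
    simpa [hL, Pi.div_def] using (hlim _ hzlim).div (hlim (fun _ => 0) tendsto_const_nhds) hL
  have hθsq : Tendsto (fun N : ℕ => N * θ N ^ 2) atTop (𝓝 (s ^ 2 * varConst⁻¹)) := by
    refine (tendsto_nat_div_varK.const_mul (s ^ 2)).congr fun N => ?_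
    simp only [θ, div_pow, Real.sq_sqrt (varK_nonneg N)]
    ring
  have hquad : Tendsto (fun N : ℕ => (varConst : ℂ) * (N * w N ^ 2) / 2) atTop
      (𝓝 ((-(s ^ 2 / 2) : ℝ) : ℂ)) := by
    have h1 := (Complex.continuous_ofReal.tendsto _).comp (hθsq.const_mul (-varConst / 2))
    have h2 : -varConst / 2 * (s ^ 2 * varConst⁻¹) = -(s ^ 2 / 2) := by
      have := varConst_pos.ne'
      field_simp
    rw [h2] at h1
    refine h1.congr fun N => ?_
    simp only [Function.comp_apply, w, mul_pow, Complex.I_sq]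
    push_cast
    ring
  -- The remainder is N · o(w²), and N w² is bounded because it converges.
  have hrem : Tendsto (fun N : ℕ => (N : ℂ) *
      (h (w N) - (meanConst * w N + varConst * w N ^ 2 / 2))) atTop (𝓝 0) := by
    have h1 := (isBigO_refl (fun N : ℕ => (N : ℂ)) atTop).mul_isLittleO (hexpand.comp_tendsto hw)
    refine (isLittleO_one_iff ℂ).1 (h1.trans_isBigO ?_)
    have h2 := hquad.const_mul (2 / (varConst : ℂ))
    refine (h2.isBigO_one ℂ).congr_left fun N => ?_
    have : (varConst : ℂ) ≠ 0 := by exact_mod_cast varConst_pos.ne'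
    simp only [Function.comp_apply]
    field_simp
  have hmean : Tendsto (fun N : ℕ => w N * (meanK N - meanConst * N)) atTop (𝓝 0) := by
    have h1 : Tendsto (fun N : ℕ => θ N * (meanK N - meanConst * N)) atTop (𝓝 0) :=
      (isLittleO_one_iff ℝ).1 ((((isLittleO_one_iff ℝ).2 hθ).mul_isBigO
        meanK_sub_isBigO).congr_right fun _ => mul_one 1)
    have h2 := ((Complex.continuous_ofReal.tendsto 0).comp h1).mul_const Complex.I
    rw [Complex.ofReal_zero, zero_mul] at h2
    refine h2.congr fun N => ?_
    simp only [Function.comp_apply, w]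
    push_cast
    ring
  -- The exponent is N times the remainder of h, minus w(E[K_N] - C₁N), plus C₂Nw²/2; only the last
  -- survives in the limit.
  have hexponent : Tendsto (fun N : ℕ => (N : ℂ) * h (w N) - w N * meanK N) atTop
      (𝓝 ((-(s ^ 2 / 2) : ℝ) : ℂ)) := by
    have h1 := (hrem.sub hmean).add hquad
    rw [sub_zero, zero_add] at h1
    exact h1.congr fun N => by ring
  have hprod := ((Complex.continuous_exp.tendsto _).comp hexponent).mul hratio
  rw [mul_one] at hprod
  refine hprod.congr' ?_
  filter_upwards [hw.eventually heq] with N hN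
  rw [charFun_normalized N s (h (w N)) hN]
  rfl

theorem mainTheorem1 :
    (fun N : ℕ => meanK N - meanConst * N) =O[atTop] (fun _ => (1 : ℝ)) ∧
    (fun N : ℕ => varK N - varConst * N) =O[atTop] (fun _ => (1 : ℝ)) ∧
    |meanConst - 0.123769| < 0.000001 ∧
    |varConst - 0.023820| < 0.000001 ∧
    TendstoInDistribution
      (fun (N : ℕ) (m : ℕ) => (summandCount m - meanK N) / √(varK N))
      atTop (id : ℝ → ℝ) (fun N => uniformBelow N) (gaussianReal 0 1) := by
  refine ⟨meanK_sub_isBigO, varK_sub_isBigO, abs_meanConst_sub_lt, abs_varConst_sub_lt, ?_⟩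
  refine ⟨fun N => (Measurable.of_discrete).aemeasurable, by fun_prop, ?_⟩
  refine ProbabilityMeasure.tendsto_iff_tendsto_charFun.2 fun s => ?_
  simpa [charFun_gaussianReal] using tendsto_charFun_normalized s
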